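/- Let $\mathcal{G}$ be a nonempty Hausdorff étale groupoid (a topological groupoid, Hausdorff as a space, whose domain and range maps $\gamma\mapsto\gamma^{-1}\gamma$ and $\gamma\mapsto\gamma\gamma^{-1}$ onto the unit space $\mathcal{G}^{(0)}$ are local homeomorphisms) with compact unit space, and let $p\in[1,\infty)\setminus\{2\}$. Let $C_c(\mathcal{G})$ be the algebra of compactly supported continuous functions $\mathcal{G}\to\mathbb{C}$ with the convolution $(f*g)(\gamma)=\sum_{\sigma\in\mathcal{G},\ \mathrm{dom}(\sigma)=\mathrm{dom}(\gamma)} f(\gamma\sigma^{-1})g(\sigma)$. For $x\in\mathcal{G}^{(0)}$ put $\mathcal{G}x=\{\gamma\in\mathcal{G}:\mathrm{dom}(\gamma)=x\}$ and let $\pi_x$ be the representation of $C_c(\mathcal{G})$ on $\ell^p(\mathcal{G}x)$ by left convolution, $\pi_x(f)\xi=f*\xi$. The reduced groupoid $L^p$-operator algebra $F^p_\lambda(\mathcal{G})$ is the completion of $C_c(\mathcal{G})$ in the norm $\|f\|_\lambda=\sup_{x\in\mathcal{G}^{(0)}}\|\pi_x(f)\|$; it is a unital Banach algebra. For a unital complex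 Banach algebra $A$, let $A_{\mathrm{h}}$ be the set of hermitian elements, that is, of those $a\in A$ with $\|\exp(ita)\|=1$ for all $t\in\mathbb{R}$. The $C^*$-core of a unital $L^p$-operator algebra $A$ is $\mathrm{core}(A)=A_{\mathrm{h}}+iA_{\mathrm{h}}$. Then the homomorphism $C(\mathcal{G}^{(0)})\to F^p_\lambda(\mathcal{G})$ that extends a function on $\mathcal{G}^{(0)}$ by zero to $\mathcal{G}$ is isometric, and its image is the $C^*$-core of $F^p_\lambda(\mathcal{G})$. In short, with $C(\mathcal{G}^{(0)})$ identified with its image, \[ \mathrm{core}\big(F^p_\lambda(\mathcal{G})\big)=C(\mathcal{G}^{(0)}). \] -/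

import Mathlib

open Topology
open scoped ENNReal CompactlySupported

noncomputable section

namespace LpGroupoid

/-! ### Topological groupoids -/

/-- A topological groupoid: a topological space with a set of composable pairs of arrows, a
continuous composition of composable pairs and a continuous inversion. The composition is
recorded as a total function, about whose values outside the composable pairs nothing is
assumed. -/
class TopologicalGroupoid (G : Type*) [TopologicalSpace G] where
  /-- The set of composable pairs of arrows. -/
  composable : Set (G × G)
  /-- The composition (only meaningful on composable pairs). -/
  mul : G → G → G
  /-- The inversion. -/
  inv : G → G
  continuousOn_mul : ContinuousOn (fun q : G × G => mul q.1 q.2) composable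
  continuous_inverse : Continuous inv
  mul_mem_left : ∀ {a b c : G}, (a, b) ∈ composable → (b, c) ∈ composable →
    (mul a b, c) ∈ composable
  mul_mem_right : ∀ {a b c : G}, (a, b) ∈ composable → (b, c) ∈ composable →
    (a, mul b c) ∈ composable
  assoc : ∀ {a b c : G}, (a, b) ∈ composable → (b, c) ∈ composable →
    mul (mul a b) c = mul a (mul b c)
  inverse_inverse : ∀ a : G, inv (inv a) = a
  mem_inv : ∀ a : G, (a, inv a) ∈ composable
  inv_mul_mul : ∀ {a b : G}, (a, b) ∈ composable → mul (inv a) (mul a b) = b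
  mul_mul_inv : ∀ {a b : G}, (a, b) ∈ composable → mul (mul a b) (inv b) = a

section Groupoid

open TopologicalGroupoid

variable {G : Type*} [TopologicalSpace G] [TopologicalGroupoid G]

/-- The domain (source) `a⁻¹ a` of an arrow `a`. -/
def dom (a : G) : G := mul (inv a) a

/-- The range (target) `a a⁻¹` of an arrow `a`. -/
def ran (a : G) : G := mul a (inv a)

variable (G) in
/-- The unit space: the set of all `a` with `a = a⁻¹ = a a`
(the pair `(a, a)` is composable as soon as `a = a⁻¹`). -/
def units : Set G := {a | a = inv a ∧ a = mul a a}

theorem inv_mem (a : G) : (inv a, a) ∈ composable := by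
  have := mem_inv (inv a)
  rwa [inverse_inverse] at this

theorem ran_inv (a : G) : ran (inv a) = dom a := by
  rw [ran, dom, inverse_inverse]

theorem dom_inv (a : G) : dom (inv a) = ran a := by
  rw [ran, dom, inverse_inverse]

theorem ran_mul_self (a : G) : mul (ran a) a = a := by
  have := mul_mul_inv (mem_inv a)
  rwa [inverse_inverse] at this

theorem mul_dom_self (a : G) : mul a (dom a) = a := by
  have := inv_mul_mul (inv_mem a)
  rwa [inverse_inverse] at this

theorem composable_iff {a b : G} : (a, b) ∈ composable ↔ dom a = ran b := by
  constructor
  · intro h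
    have h1 := mul_mul_inv (mul_mem_left (inv_mem a) h)
    rw [assoc (inv_mem a) h, inv_mul_mul h] at h1
    exact h1.symm
  · intro h
    have h1 : (dom a, b) ∈ composable := by
      rw [h]; exact mul_mem_left (mem_inv b) (inv_mem b)
    have h2 : (a, dom a) ∈ composable := mul_mem_right (mem_inv a) (inv_mem a)
    have h3 := mul_mem_left h2 h1
    rwa [mul_dom_self] at h3

theorem dom_mul {a b : G} (h : dom a = ran b) : dom (mul a b) = dom b := by
  have := composable_iff.1 (mul_mem_left (composable_iff.2 h) (mem_inv b))
  rwa [ran_inv] at this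

theorem ran_mul {a b : G} (h : dom a = ran b) : ran (mul a b) = ran a := by
  have := composable_iff.1 (mul_mem_right (inv_mem a) (composable_iff.2 h))
  rw [dom_inv] at this
  exact this.symm

theorem inv_mul {a b : G} (h : dom a = ran b) : inv (mul a b) = mul (inv b) (inv a) := by
  have hab : (a, b) ∈ composable := composable_iff.2 h
  have hba : (inv b, inv a) ∈ composable := by
    rw [composable_iff, dom_inv, ran_inv, h]
  have h1 : (mul a b, inv b) ∈ composable := mul_mem_left hab (mem_inv b)
  have h2 : mul (mul a b) (mul (inv b) (inv a)) = ran (mul a b) := by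
    rw [← assoc h1 hba, mul_mul_inv hab, ran_mul h, ran]
  have h3 := inv_mul_mul (mul_mem_right h1 hba)
  rw [h2, ran, inv_mul_mul (mem_inv (mul a b))] at h3
  exact h3

theorem dom_mem_units (a : G) : dom a ∈ units G := by
  constructor
  · rw [dom, inv_mul (dom_inv a), inverse_inverse]
  · have := ran_mul_self (dom a)
    rw [show ran (dom a) = dom a by rw [dom, ran_mul (dom_inv a), ran_inv, dom]] at this
    exact this.symm

theorem ran_mem_units (a : G) : ran a ∈ units G := by
  rw [← dom_inv]
  exact dom_mem_units _

theorem dom_of_mem_units {a : G} (h : a ∈ units G) : dom a = a := by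
  rw [dom, ← h.1, ← h.2]

theorem ran_of_mem_units {a : G} (h : a ∈ units G) : ran a = a := by
  rw [ran, ← h.1, ← h.2]

/-- The domain map as a map to the unit space. -/
def domMap (a : G) : units G := ⟨dom a, dom_mem_units a⟩

/-- The range map as a map to the unit space. -/
def ranMap (a : G) : units G := ⟨ran a, ran_mem_units a⟩

variable (G) in
/-- A topological groupoid is étale if its domain and range maps (as maps to the unit space)
are local homeomorphisms. -/
class IsEtale : Prop where
  isLocalHomeomorph_dom : IsLocalHomeomorph (domMap : G → units G)
  isLocalHomeomorph_ran : IsLocalHomeomorph (ranMap : G → units G)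

theorem dom_mul_inv {a b : G} (h : dom b = dom a) : dom (mul a (inv b)) = ran b := by
  rw [dom_mul (by rw [ran_inv, h]), dom_inv]

theorem ran_mul_inv {a b : G} (h : dom b = dom a) : ran (mul a (inv b)) = ran a :=
  ran_mul (by rw [ran_inv, h])

theorem mul_inv_mul {a b : G} (h : dom b = dom a) : mul (mul a (inv b)) b = a := by
  have := mul_mul_inv (composable_iff.2 (show dom a = ran (inv b) by rw [ran_inv, h]))
  rwa [inverse_inverse] at this

theorem mul_inv_eq_right {a b c : G} (hb : dom b = dom a) (hc : dom c = dom a)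
    (h : mul a (inv b) = mul a (inv c)) : b = c := by
  have h1 := inv_mul_mul
    (composable_iff.2 (show dom a = ran (inv b) by rw [ran_inv, hb]))
  have h2 := inv_mul_mul
    (composable_iff.2 (show dom a = ran (inv c) by rw [ran_inv, hc]))
  rw [h, h2] at h1
  rw [← inverse_inverse b, ← h1, inverse_inverse]

theorem mul_inv_eq_left {a b c : G} (ha : dom c = dom a) (hb : dom c = dom b)
    (h : mul a (inv c) = mul b (inv c)) : a = b := by
  rw [← mul_inv_mul ha, h, mul_inv_mul hb]

/-- `(a c⁻¹) (b c⁻¹)⁻¹ = a b⁻¹`. -/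
theorem mul_inv_mul_inv {a b c : G} (ha : dom c = dom a) (hb : dom c = dom b) :
    mul (mul a (inv c)) (inv (mul b (inv c))) = mul a (inv b) := by
  have hbc : dom b = ran (inv c) := by rw [ran_inv, hb]
  rw [inv_mul hbc, inverse_inverse]
  have h1 : (mul a (inv c), c) ∈ composable := by
    rw [composable_iff, dom_mul_inv ha]
  have h2 : (c, inv b) ∈ composable := by
    rw [composable_iff, ran_inv, hb]
  rw [← assoc h1 h2, mul_inv_mul ha]

theorem continuous_dom : Continuous (dom : G → G) :=
  continuousOn_mul.comp_continuous (continuous_inverse.prodMk continuous_id) inv_mem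

theorem continuous_ran : Continuous (ran : G → G) :=
  continuousOn_mul.comp_continuous (continuous_id.prodMk continuous_inverse) mem_inv

theorem isClosed_composable [T2Space G] :
    IsClosed (composable : Set (G × G)) := by
  have : (composable : Set (G × G)) = {q | dom q.1 = ran q.2} := by
    ext ⟨a, b⟩; exact composable_iff
  rw [this]
  exact isClosed_eq (continuous_dom.comp continuous_fst) (continuous_ran.comp continuous_snd)

theorem isClosed_units [T2Space G] : IsClosed (units G) := by
  have : units G = {a | dom a = a} := by
    ext a
    exact ⟨dom_of_mem_units, fun h => h ▸ dom_mem_units a⟩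
  rw [this]
  exact isClosed_eq continuous_dom continuous_id

theorem isOpen_units [IsEtale G] : IsOpen (units G) := by
  rw [isOpen_iff_mem_nhds]
  intro x hx
  set e := (IsEtale.isLocalHomeomorph_dom (G := G)).localInverseAt x
  have hinj := (IsEtale.isLocalHomeomorph_dom (G := G)).injOn_localInverseAt_target (x := x)
  have hU : e.target ∈ 𝓝 x := e.open_target.mem_nhds
    (IsEtale.isLocalHomeomorph_dom (G := G)).self_mem_localInverseAt_target
  have hU' : dom ⁻¹' e.target ∈ 𝓝 x := by
    apply continuous_dom.continuousAt.preimage_mem_nhds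
    rwa [dom_of_mem_units hx]
  filter_upwards [hU, hU'] with a ha ha'
  have : a = dom a := hinj ha ha' (Subtype.ext (dom_of_mem_units (dom_mem_units a)).symm)
  rw [this]
  exact dom_mem_units a

/-- Points of a compact set in the fibres of a locally injective map are uniformly bounded in
number. -/
theorem exists_encard_fiber_le {X Y : Type*} [TopologicalSpace X] [TopologicalSpace Y]
    {h : X → Y} (hh : IsLocalHomeomorph h) {K : Set X} (hK : IsCompact K) :
    ∃ N : ℕ, ∀ y, (K ∩ h ⁻¹' {y}).encard ≤ N := by
  refine hK.induction_on (p := fun s => ∃ N : ℕ, ∀ y, (s ∩ h ⁻¹' {y}).encard ≤ N) ?_ ?_ ?_ ?_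
  · exact ⟨0, fun y => by simp⟩
  · rintro s t hst ⟨N, hN⟩
    exact ⟨N, fun y => (Set.encard_le_encard (Set.inter_subset_inter_left _ hst)).trans (hN y)⟩
  · rintro s t ⟨N, hN⟩ ⟨M, hM⟩
    refine ⟨N + M, fun y => ?_⟩
    rw [Set.union_inter_distrib_right]
    push_cast
    exact (Set.encard_union_le _ _).trans (add_le_add (hN y) (hM y))
  · intro x _
    refine ⟨(hh.localInverseAt x).target, mem_nhdsWithin_of_mem_nhds
      ((hh.localInverseAt x).open_target.mem_nhds hh.self_mem_localInverseAt_target), 1, ?_⟩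
    intro y
    rw [Nat.cast_one, Set.encard_le_one_iff]
    rintro a b ⟨ha, ha'⟩ ⟨hb, hb'⟩
    exact hh.injOn_localInverseAt_target ha hb (ha'.trans hb'.symm)

end Groupoid

/-! ### Convolution -/

section Convolution

open TopologicalGroupoid

variable {G : Type*} [TopologicalSpace G] [TopologicalGroupoid G]

/-- The set of arrows with domain `x`. -/
abbrev Fiber (x : G) : Type _ := {a : G // dom a = x}

/-- Left convolution by `f` of functions on the arrows with domain `x`:
`(f * ξ)(a) = ∑ f(a b⁻¹) ξ(b)`, where `b` runs through the arrows with domain `x`.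
(For `f` continuous of compact support on an étale groupoid, only finitely many summands are
nonzero.) -/
def fiberConv (x : G) (f : G → ℂ) (ξ : Fiber x → ℂ) (a : Fiber x) : ℂ :=
  ∑ᶠ b : Fiber x, f (mul a.1 (inv b.1)) * ξ b

/-- The convolution `(f * g)(a) = ∑ f(a b⁻¹) g(b)`, where `b` runs through the arrows with
`dom b = dom a`. -/
def conv (f g : G → ℂ) (a : G) : ℂ :=
  ∑ᶠ b : Fiber (dom a), f (mul a (inv b.1)) * g b.1

theorem conv_eq_fiberConv (f g : G → ℂ) (x : G) (a : Fiber x) :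
    conv f g a.1 = fiberConv x f (fun b => g b.1) a := by
  obtain ⟨a, rfl⟩ := a
  rfl

/-- A function whose support meets all fibres of the domain and range maps in at most `N` points. -/
def FiberBound (f : G → ℂ) (N : ℕ) : Prop :=
  (∀ y, {a | ran a = y ∧ f a ≠ 0}.encard ≤ N) ∧ (∀ y, {a | dom a = y ∧ f a ≠ 0}.encard ≤ N)

theorem exists_fiberBound [IsEtale G] (f : C_c(G, ℂ)) : ∃ N, FiberBound f N := by
  obtain ⟨N, hN⟩ := exists_encard_fiber_le (IsEtale.isLocalHomeomorph_ran (G := G))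
    f.hasCompactSupport.isCompact
  obtain ⟨M, hM⟩ := exists_encard_fiber_le (IsEtale.isLocalHomeomorph_dom (G := G))
    f.hasCompactSupport.isCompact
  refine ⟨max N M, fun y => ?_, fun y => ?_⟩
  · by_cases hy : y ∈ units G
    · refine le_trans (Set.encard_le_encard ?_)
        ((hN ⟨y, hy⟩).trans (by exact_mod_cast le_max_left N M))
      rintro a ⟨h1, h2⟩
      exact ⟨subset_tsupport _ h2, Subtype.ext h1⟩
    · rw [show {a | ran a = y ∧ f a ≠ 0} = ∅ from ?_]
      · simp
      · ext a
        simp only [Set.mem_ofPred_eq, Set.mem_empty_iff_false, iff_false, not_and]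
        exact fun h => absurd (h ▸ ran_mem_units a) hy
  · by_cases hy : y ∈ units G
    · refine le_trans (Set.encard_le_encard ?_)
        ((hM ⟨y, hy⟩).trans (by exact_mod_cast le_max_right N M))
      rintro a ⟨h1, h2⟩
      exact ⟨subset_tsupport _ h2, Subtype.ext h1⟩
    · rw [show {a | dom a = y ∧ f a ≠ 0} = ∅ from ?_]
      · simp
      · ext a
        simp only [Set.mem_ofPred_eq, Set.mem_empty_iff_false, iff_false, not_and]
        exact fun h => absurd (h ▸ dom_mem_units a) hy

theorem FiberBound.row {f : G → ℂ} {N : ℕ} (h : FiberBound f N) {x : G} (a : Fiber x) :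
    {b : Fiber x | f (mul a.1 (inv b.1)) ≠ 0}.encard ≤ N := by
  have hinj : Set.InjOn (fun b : Fiber x => mul a.1 (inv b.1))
      {b : Fiber x | f (mul a.1 (inv b.1)) ≠ 0} := fun b _ c _ hbc =>
    Subtype.ext (mul_inv_eq_right (b.2.trans a.2.symm) (c.2.trans a.2.symm) hbc)
  rw [← hinj.encard_image]
  refine le_trans (Set.encard_le_encard ?_) (h.1 (ran a.1))
  rintro _ ⟨b, hb, rfl⟩
  exact ⟨ran_mul_inv (b.2.trans a.2.symm), hb⟩

theorem FiberBound.col {f : G → ℂ} {N : ℕ} (h : FiberBound f N) {x : G} (b : Fiber x) :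
    {a : Fiber x | f (mul a.1 (inv b.1)) ≠ 0}.encard ≤ N := by
  have hinj : Set.InjOn (fun a : Fiber x => mul a.1 (inv b.1))
      {a : Fiber x | f (mul a.1 (inv b.1)) ≠ 0} := fun a _ c _ hac =>
    Subtype.ext (mul_inv_eq_left (b.2.trans a.2.symm) (b.2.trans c.2.symm) hac)
  rw [← hinj.encard_image]
  refine le_trans (Set.encard_le_encard ?_) (h.2 (ran b.1))
  rintro _ ⟨a, ha, rfl⟩
  exact ⟨dom_mul_inv (b.2.trans a.2.symm), ha⟩

theorem FiberBound.finite_row {f : G → ℂ} {N : ℕ} (h : FiberBound f N) {x : G} (a : Fiber x) :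
    {b : Fiber x | f (mul a.1 (inv b.1)) ≠ 0}.Finite :=
  Set.finite_of_encard_le_coe (h.row a)

theorem fiberConv_eq_sum {x : G} {f : G → ℂ} {ξ : Fiber x → ℂ} {a : Fiber x}
    {R : Finset (Fiber x)} (hR : ∀ b : Fiber x, f (mul a.1 (inv b.1)) ≠ 0 → b ∈ R) :
    fiberConv x f ξ a = ∑ b ∈ R, f (mul a.1 (inv b.1)) * ξ b := by
  refine finsum_eq_sum_of_support_subset _ fun b hb => hR b ?_
  exact left_ne_zero_of_mul hb

/-- Right translation by the inverse of an arrow, as a bijection of fibres. -/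
def fiberShift {x : G} (c : Fiber x) : Fiber x ≃ Fiber (ran c.1) where
  toFun b := ⟨mul b.1 (inv c.1), dom_mul_inv (c.2.trans b.2.symm)⟩
  invFun b := ⟨mul b.1 c.1, by rw [dom_mul b.2, c.2]⟩
  left_inv b := Subtype.ext (mul_inv_mul (c.2.trans b.2.symm))
  right_inv b := Subtype.ext (mul_mul_inv (composable_iff.2 b.2))

theorem conv_mul_inv (f g : G → ℂ) {x : G} (a c : Fiber x) :
    conv f g (mul a.1 (inv c.1)) =
      ∑ᶠ b : Fiber x, f (mul a.1 (inv b.1)) * g (mul b.1 (inv c.1)) := by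
  have h1 := conv_eq_fiberConv f g (ran c.1) (fiberShift c a)
  change conv f g (mul a.1 (inv c.1)) = _ at h1
  rw [h1, fiberConv, ← finsum_comp_equiv (fiberShift c)]
  refine finsum_congr fun b => ?_
  simp only [fiberShift, Equiv.coe_fn_mk]
  rw [mul_inv_mul_inv (c.2.trans a.2.symm) (c.2.trans b.2.symm)]

theorem fiberConv_fiberConv {f g : G → ℂ} {N M : ℕ} (hf : FiberBound f N) (hg : FiberBound g M)
    {x : G} (ξ : Fiber x → ℂ) :
    fiberConv x f (fiberConv x g ξ) = fiberConv x (conv f g) ξ := by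
  classical
  ext a
  set R := (hf.finite_row a).toFinset with hRdef
  have hR : ∀ b : Fiber x, f (mul a.1 (inv b.1)) ≠ 0 → b ∈ R := fun b hb => by simpa [hRdef] using hb
  set T := R.biUnion fun b => (hg.finite_row b).toFinset with hTdef
  have hT : ∀ b ∈ R, ∀ c : Fiber x, g (mul b.1 (inv c.1)) ≠ 0 → c ∈ T := fun b hb c hc => by
    rw [hTdef, Finset.mem_biUnion]
    exact ⟨b, hb, by simpa using hc⟩
  have hconv : ∀ c : Fiber x, conv f g (mul a.1 (inv c.1)) =
      ∑ b ∈ R, f (mul a.1 (inv b.1)) * g (mul b.1 (inv c.1)) := fun c => by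
    rw [conv_mul_inv]
    exact finsum_eq_sum_of_support_subset _ fun b hb => hR b (left_ne_zero_of_mul hb)
  rw [fiberConv_eq_sum hR, fiberConv_eq_sum (R := T)]
  · simp_rw [hconv, Finset.sum_mul]
    rw [Finset.sum_comm]
    refine Finset.sum_congr rfl fun b hb => ?_
    rw [fiberConv_eq_sum (hT b hb), Finset.mul_sum]
    exact Finset.sum_congr rfl fun c _ => by ring
  · intro c hc
    rw [hconv] at hc
    obtain ⟨b, hb, hbc⟩ := Finset.exists_ne_zero_of_sum_ne_zero hc
    exact hT b hb c (right_ne_zero_of_mul hbc)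

theorem conv_assoc {f g : G → ℂ} {N M : ℕ} (hf : FiberBound f N) (hg : FiberBound g M)
    (h : G → ℂ) : conv (conv f g) h = conv f (conv g h) := by
  ext a
  have h1 := conv_eq_fiberConv (conv f g) h (dom a) ⟨a, rfl⟩
  have h2 := conv_eq_fiberConv f (conv g h) (dom a) ⟨a, rfl⟩
  simp only at h1 h2
  rw [h1, h2, ← fiberConv_fiberConv hf hg]
  congr 1
  ext b
  exact (conv_eq_fiberConv g h (dom a) b).symm

theorem continuous_conv [T2Space G] [IsEtale G] (f g : C_c(G, ℂ)) : Continuous (conv f g) := by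
  classical
  rw [continuous_iff_continuousAt]
  intro a₀
  have hd := IsEtale.isLocalHomeomorph_dom (G := G)
  set K := tsupport g with hKdef
  have hK : IsCompact K := g.hasCompactSupport.isCompact
  set x₀ : units G := domMap a₀
  obtain ⟨N, hN⟩ := exists_encard_fiber_le hd hK
  have hfin : (K ∩ domMap ⁻¹' {x₀}).Finite := Set.finite_of_encard_le_coe (hN x₀)
  set S : Finset G := hfin.toFinset with hSdef
  have hS : ∀ s ∈ S, domMap s = x₀ := fun s hs => ((hfin.mem_toFinset).1 hs).2
  let e : G → OpenPartialHomeomorph (units G) G := fun s => hd.localInverseAt s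
  have hex : ∀ s ∈ S, e s x₀ = s := fun s hs => by
    rw [← hS s hs]; exact hd.localInverseAt_apply_self
  have hsrc : ∀ s ∈ S, x₀ ∈ (e s).source := fun s hs => by
    rw [← hS s hs]; exact hd.apply_self_mem_localInverseAt_source
  have hec : ∀ s ∈ S, ContinuousAt (e s) x₀ := fun s hs => (e s).continuousAt (hsrc s hs)
  have ev1 : ∀ᶠ y in 𝓝 x₀, ∀ s ∈ S, y ∈ (e s).source := by
    rw [Filter.eventually_all_finset]
    exact fun s hs => (e s).open_source.mem_nhds (hsrc s hs)
  have ev2 : ∀ᶠ y in 𝓝 x₀, ∀ s ∈ S, ∀ t ∈ S, s ≠ t → e s y ≠ e t y := by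
    rw [Filter.eventually_all_finset]
    intro s hs
    rw [Filter.eventually_all_finset]
    intro t ht
    by_cases hst : s = t
    · simp [hst]
    · have hne : e s x₀ ≠ e t x₀ := by rwa [hex s hs, hex t ht]
      filter_upwards [((hec s hs).ne_iff_eventually_ne (hec t ht)).1 hne] with y hy _ using hy
  have ev3 : ∀ᶠ y in 𝓝 x₀, ∀ a ∈ K, domMap a = y → ∃ s ∈ S, a = e s y := by
    set W : Set G := ⋃ s ∈ S, (e s).target
    have hW : IsOpen W := isOpen_biUnion fun s _ => (e s).open_target
    have hC : IsClosed (domMap '' (K \ W)) := ((hK.diff hW).image hd.continuous).isClosed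
    have hx : x₀ ∉ domMap '' (K \ W) := by
      rintro ⟨a, ⟨haK, haW⟩, ha⟩
      refine haW (Set.mem_biUnion (x := a) ?_ hd.self_mem_localInverseAt_target)
      exact hfin.mem_toFinset.2 ⟨haK, ha⟩
    filter_upwards [hC.isOpen_compl.mem_nhds hx] with y hy a haK hay
    have haW : a ∈ W := by
      by_contra hcon
      exact hy ⟨a, ⟨haK, hcon⟩, hay⟩
    obtain ⟨s, hs, has⟩ := Set.mem_iUnion₂.1 haW
    refine ⟨s, hs, ?_⟩
    have := (e s).right_inv has
    rw [← hay]
    conv_lhs => rw [← this]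
    congr 1
    exact congrFun (hd.localInverseAt_symm s) a
  have hdc : ContinuousAt (domMap : G → units G) a₀ := hd.continuous.continuousAt
  have key : ∀ᶠ a in 𝓝 a₀, conv f g a =
      ∑ s ∈ S, f (mul a (inv (e s (domMap a)))) * g (e s (domMap a)) := by
    filter_upwards [hdc.eventually ev1, hdc.eventually ev2, hdc.eventually ev3] with a h1 h2 h3
    have hinj : Set.InjOn (fun s => e s (domMap a)) S := fun s hs t ht hst => by
      by_contra hne
      exact h2 s hs t ht hne hst
    rw [← Finset.sum_image (f := fun b => f (mul a (inv b)) * g b) hinj, conv]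
    refine (finsum_set_coe_eq_finsum_mem (f := fun b => f (mul a (inv b)) * g b)
      {b | dom b = dom a}).trans ?_
    refine finsum_mem_eq_sum_of_inter_support_eq (s := {b | dom b = dom a}) _ ?_
    ext b
    simp only [Set.mem_inter_iff, Set.mem_ofPred_eq, Function.mem_support, Finset.coe_image,
      Set.mem_image, Finset.mem_coe]
    refine and_congr_left fun hb => ⟨fun hba => ?_, ?_⟩
    · obtain ⟨s, hs, hbs⟩ := h3 b (subset_tsupport _ (right_ne_zero_of_mul hb)) (Subtype.ext hba)
      exact ⟨s, hs, hbs.symm⟩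
    · rintro ⟨s, hs, rfl⟩
      exact congrArg Subtype.val (hd.apply_localInverseAt_of_mem (h1 s hs))
  refine ContinuousAt.congr ?_ (key.mono fun _ h => h.symm)
  refine tendsto_finsetSum _ fun s hs => ?_
  have c1 : ContinuousAt (fun a => e s (domMap a)) a₀ := (hec s hs).comp hdc
  have c2 : ContinuousAt (fun a => mul a (inv (e s (domMap a)))) a₀ := by
    have hmem : (a₀, inv (e s (domMap a₀))) ∈ (composable : Set (G × G)) := by
      rw [composable_iff, ran_inv]
      exact (congrArg Subtype.val (hd.apply_localInverseAt_of_mem (hsrc s hs))).symm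
    have := (continuousOn_mul (G := G)) _ hmem
    refine Filter.Tendsto.comp (f := fun a => (a, inv (e s (domMap a)))) this ?_
    rw [tendsto_nhdsWithin_iff]
    refine ⟨(continuousAt_id.prodMk (continuous_inverse.continuousAt.comp c1)), ?_⟩
    filter_upwards [hdc.eventually ev1] with a h1
    rw [composable_iff, ran_inv]
    exact (congrArg Subtype.val (hd.apply_localInverseAt_of_mem (h1 s hs))).symm
  exact ((map_continuous f).continuousAt.comp c2).mul ((map_continuous g).continuousAt.comp c1)

theorem hasCompactSupport_conv [T2Space G] (f g : C_c(G, ℂ)) : HasCompactSupport (conv f g) := by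
  have hcomp : IsCompact ((fun q : G × G => mul q.1 q.2) ''
      ((tsupport f ×ˢ tsupport g) ∩ composable)) :=
    ((f.hasCompactSupport.isCompact.prod g.hasCompactSupport.isCompact).inter_right
      isClosed_composable).image_of_continuousOn
      (continuousOn_mul.mono Set.inter_subset_right)
  refine HasCompactSupport.intro hcomp fun a ha => ?_
  rw [conv, ← finsum_zero (α := Fiber (dom a))]
  refine finsum_congr fun b => ?_
  by_contra hne
  refine ha ⟨(mul a (inv b.1), b.1), ⟨⟨?_, ?_⟩, ?_⟩, mul_inv_mul b.2⟩
  · exact subset_tsupport _ (left_ne_zero_of_mul hne)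
  · exact subset_tsupport _ (right_ne_zero_of_mul hne)
  · rw [composable_iff, dom_mul_inv b.2]

/-- The convolution of two continuous functions of compact support. -/
def convC [T2Space G] [IsEtale G] (f g : C_c(G, ℂ)) : C_c(G, ℂ) where
  toFun := conv f g
  continuous_toFun := continuous_conv f g
  hasCompactSupport' := hasCompactSupport_conv f g

end Convolution

/-! ### The left regular representations -/

/-- The complex Banach space `ℓ^p(S)`. -/
abbrev EllP (p : ℝ≥0∞) (S : Type*) : Type _ := lp (fun _ : S => ℂ) p

section Schur

variable {S : Type*} {A : S → S → ℂ} {N : ℕ} {C : ℝ}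

theorem schur_finite (hrow : ∀ s, {t | A s t ≠ 0}.encard ≤ N) (hC : ∀ s t, ‖A s t‖ ≤ C)
    (hcol : ∀ t, {s | A s t ≠ 0}.encard ≤ N) {q : ℝ} (hq : 1 ≤ q) (ξ : S → ℂ) (B : ℝ)
    (hB : ∀ T : Finset S, ∑ t ∈ T, ‖ξ t‖ ^ q ≤ B ^ q) (hB0 : 0 ≤ B) (hC0 : 0 ≤ C)
    (F : Finset S) :
    ∑ s ∈ F, ‖∑ᶠ t, A s t * ξ t‖ ^ q ≤ (N * C * B) ^ q := by
  classical
  have hfin : ∀ s, {t | A s t ≠ 0}.Finite := fun s => Set.finite_of_encard_le_coe (hrow s)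
  set R : S → Finset S := fun s => (hfin s).toFinset with hR
  have hRmem : ∀ s t, t ∈ R s ↔ A s t ≠ 0 := fun s t => by simp [hR]
  have hRcard : ∀ s, (R s).card ≤ N := fun s => by
    have := hrow s
    rw [← (hfin s).coe_toFinset, Set.encard_coe_eq_coe_finsetCard] at this
    exact_mod_cast this
  have hq0 : 0 ≤ q := zero_le_one.trans hq
  have step : ∀ s, ‖∑ᶠ t, A s t * ξ t‖ ^ q ≤
      C ^ q * ((N : ℝ) ^ (q - 1) * ∑ t ∈ R s, ‖ξ t‖ ^ q) := fun s => by
    rw [finsum_eq_sum_of_support_subset (s := R s) _ fun t ht =>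
      (hRmem s t).2 (left_ne_zero_of_mul ht)]
    have h1 : ‖∑ t ∈ R s, A s t * ξ t‖ ≤ C * ∑ t ∈ R s, ‖ξ t‖ := by
      rw [Finset.mul_sum]
      refine (norm_sum_le _ _).trans (Finset.sum_le_sum fun t _ => ?_)
      rw [norm_mul]
      exact mul_le_mul_of_nonneg_right (hC s t) (norm_nonneg _)
    refine (Real.rpow_le_rpow (norm_nonneg _) h1 hq0).trans ?_
    rw [Real.mul_rpow hC0 (Finset.sum_nonneg fun _ _ => norm_nonneg _)]
    refine mul_le_mul_of_nonneg_left ?_ (Real.rpow_nonneg hC0 _)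
    refine (Real.rpow_sum_le_const_mul_sum_rpow_of_nonneg (R s) hq
      fun _ _ => norm_nonneg _).trans ?_
    refine mul_le_mul_of_nonneg_right ?_
      (Finset.sum_nonneg fun _ _ => Real.rpow_nonneg (norm_nonneg _) _)
    exact Real.rpow_le_rpow (Nat.cast_nonneg _) (by exact_mod_cast hRcard s) (by linarith)
  have count : ∑ s ∈ F, ∑ t ∈ R s, ‖ξ t‖ ^ q ≤ N * B ^ q := by
    set T := F.biUnion R
    have h1 : ∀ s ∈ F, ∑ t ∈ R s, ‖ξ t‖ ^ q =
        ∑ t ∈ T, if A s t ≠ 0 then ‖ξ t‖ ^ q else 0 := fun s hs => by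
      rw [← Finset.sum_filter]
      refine Finset.sum_congr ?_ fun _ _ => rfl
      ext t
      rw [Finset.mem_filter, ← hRmem]
      exact ⟨fun h => ⟨Finset.mem_biUnion.2 ⟨s, hs, h⟩, h⟩, fun h => h.2⟩
    rw [Finset.sum_congr rfl h1, Finset.sum_comm]
    refine le_trans (Finset.sum_le_sum (g := fun t => (N : ℝ) * ‖ξ t‖ ^ q) fun t _ => ?_) ?_
    · rw [← Finset.sum_filter, Finset.sum_const, nsmul_eq_mul]
      refine mul_le_mul_of_nonneg_right ?_ (Real.rpow_nonneg (norm_nonneg _) _)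
      have h2 : ((F.filter fun s => A s t ≠ 0 : Finset S) : Set S).encard ≤ N := by
        refine (Set.encard_le_encard ?_).trans (hcol t)
        intro s hs
        exact (Finset.mem_filter.1 hs).2
      rw [Set.encard_coe_eq_coe_finsetCard] at h2
      exact_mod_cast h2
    · rw [← Finset.mul_sum]
      exact mul_le_mul_of_nonneg_left (hB T) (Nat.cast_nonneg _)
  calc ∑ s ∈ F, ‖∑ᶠ t, A s t * ξ t‖ ^ q
      ≤ ∑ s ∈ F, C ^ q * ((N : ℝ) ^ (q - 1) * ∑ t ∈ R s, ‖ξ t‖ ^ q) :=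
        Finset.sum_le_sum fun s _ => step s
    _ = C ^ q * ((N : ℝ) ^ (q - 1) * ∑ s ∈ F, ∑ t ∈ R s, ‖ξ t‖ ^ q) := by
        rw [← Finset.mul_sum, ← Finset.mul_sum]
    _ ≤ C ^ q * ((N : ℝ) ^ (q - 1) * (N * B ^ q)) := by
        refine mul_le_mul_of_nonneg_left (mul_le_mul_of_nonneg_left count ?_)
          (Real.rpow_nonneg hC0 _)
        exact Real.rpow_nonneg (Nat.cast_nonneg _) _
    _ = (N * C * B) ^ q := by
        rw [Real.mul_rpow (mul_nonneg (Nat.cast_nonneg _) hC0) hB0,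
          Real.mul_rpow (Nat.cast_nonneg _) hC0]
        have : (N : ℝ) ^ (q - 1) * N = (N : ℝ) ^ q := by
          rcases Nat.eq_zero_or_pos N with h | h
          · subst h
            rw [Nat.cast_zero, mul_zero, Real.zero_rpow (by linarith)]
          · rw [Real.rpow_sub_one (by positivity)]
            field_simp
        rw [← this]
        ring

theorem schur_sup (hrow : ∀ s, {t | A s t ≠ 0}.encard ≤ N) (hC : ∀ s t, ‖A s t‖ ≤ C)
    (ξ : S → ℂ) (B : ℝ) (hB : ∀ t, ‖ξ t‖ ≤ B) (hB0 : 0 ≤ B) (hC0 : 0 ≤ C) (s : S) :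
    ‖∑ᶠ t, A s t * ξ t‖ ≤ N * C * B := by
  have hfin : {t | A s t ≠ 0}.Finite := Set.finite_of_encard_le_coe (hrow s)
  have hcard : hfin.toFinset.card ≤ N := by
    have := hrow s
    rw [← hfin.coe_toFinset, Set.encard_coe_eq_coe_finsetCard] at this
    exact_mod_cast this
  rw [finsum_eq_sum_of_support_subset (s := hfin.toFinset) _ fun t ht => by
    simpa using left_ne_zero_of_mul ht]
  refine (norm_sum_le_of_le _ (f := fun t => A s t * ξ t) (n := fun _ => C * B)
    fun t _ => ?_).trans ?_
  · rw [norm_mul]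
    exact mul_le_mul (hC s t) (hB t) (norm_nonneg _) hC0
  · rw [Finset.sum_const, nsmul_eq_mul, ← _root_.mul_assoc]
    rw [_root_.mul_assoc, _root_.mul_assoc]
    exact mul_le_mul_of_nonneg_right (by exact_mod_cast hcard) (mul_nonneg hC0 hB0)

/-- A matrix with uniformly bounded entries and at most `N` nonzero entries in each row and each
column maps `ℓ^p` to `ℓ^p`. -/
theorem schur_memℓp (hrow : ∀ s, {t | A s t ≠ 0}.encard ≤ N) (hC : ∀ s t, ‖A s t‖ ≤ C)
    (hC0 : 0 ≤ C) (hcol : ∀ t, {s | A s t ≠ 0}.encard ≤ N) (p : ℝ≥0∞) [Fact (1 ≤ p)]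
    (ξ : EllP p S) : Memℓp (fun s => ∑ᶠ t, A s t * ξ t) p := by
  rcases eq_or_ne p ∞ with rfl | hp
  · refine memℓp_infty ⟨N * C * ‖ξ‖, ?_⟩
    rintro _ ⟨s, rfl⟩
    exact schur_sup hrow hC _ _ (lp.norm_apply_le_norm (by simp) ξ) (norm_nonneg _) hC0 s
  · have hq : 1 ≤ p.toReal := by
      simpa using ENNReal.toReal_mono hp (Fact.out : 1 ≤ p)
    exact memℓp_gen' (C := (N * C * ‖ξ‖) ^ p.toReal) fun F =>
      schur_finite hrow hC hcol hq _ _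
        (fun T => lp.sum_rpow_le_norm_rpow (zero_lt_one.trans_le hq) ξ T) (norm_nonneg _) hC0 F

theorem schur_norm_le (hrow : ∀ s, {t | A s t ≠ 0}.encard ≤ N) (hC : ∀ s t, ‖A s t‖ ≤ C)
    (hC0 : 0 ≤ C) (hcol : ∀ t, {s | A s t ≠ 0}.encard ≤ N) (p : ℝ≥0∞) [Fact (1 ≤ p)]
    (ξ η : EllP p S) (hη : ∀ s, η s = ∑ᶠ t, A s t * ξ t) : ‖η‖ ≤ N * C * ‖ξ‖ := by
  have h0 : 0 ≤ N * C * ‖ξ‖ := by positivity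
  rcases eq_or_ne p ∞ with rfl | hp
  · refine lp.norm_le_of_forall_le h0 fun s => ?_
    rw [hη]
    exact schur_sup hrow hC _ _ (lp.norm_apply_le_norm (by simp) ξ) (norm_nonneg _) hC0 s
  · have hq : 1 ≤ p.toReal := by
      simpa using ENNReal.toReal_mono hp (Fact.out : 1 ≤ p)
    refine lp.norm_le_of_forall_sum_le (zero_lt_one.trans_le hq) h0 fun F => ?_
    simp_rw [hη]
    exact schur_finite hrow hC hcol hq _ _
      (fun T => lp.sum_rpow_le_norm_rpow (zero_lt_one.trans_le hq) ξ T) (norm_nonneg _) hC0 F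

end Schur

section RegularRepresentation

theorem exists_norm_bound {G : Type*} [TopologicalSpace G] (f : C_c(G, ℂ)) : ∃ C : ℝ, 0 ≤ C ∧ ∀ a, ‖f a‖ ≤ C := by
  obtain ⟨C, hC⟩ := f.hasCompactSupport.exists_bound_of_continuous (map_continuous f)
  exact ⟨max C 0, le_max_right _ _, fun a => (hC a).trans (le_max_left _ _)⟩

open TopologicalGroupoid

variable {G : Type*} [TopologicalSpace G] [TopologicalGroupoid G]

theorem FiberBound.fiberConv_add {f : G → ℂ} {N : ℕ} (h : FiberBound f N) {x : G}
    (ξ η : Fiber x → ℂ) : fiberConv x f (ξ + η) = fiberConv x f ξ + fiberConv x f η := by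
  ext a
  have hR : ∀ b : Fiber x, f (mul a.1 (inv b.1)) ≠ 0 → b ∈ (h.finite_row a).toFinset :=
    fun b hb => by simpa using hb
  simp only [Pi.add_apply, fiberConv_eq_sum hR, mul_add, Finset.sum_add_distrib]

theorem FiberBound.fiberConv_smul {f : G → ℂ} {N : ℕ} (h : FiberBound f N) {x : G}
    (c : ℂ) (ξ : Fiber x → ℂ) : fiberConv x f (c • ξ) = c • fiberConv x f ξ := by
  ext a
  have hR : ∀ b : Fiber x, f (mul a.1 (inv b.1)) ≠ 0 → b ∈ (h.finite_row a).toFinset :=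
    fun b hb => by simpa using hb
  simp only [Pi.smul_apply, fiberConv_eq_sum hR, smul_eq_mul, Finset.mul_sum]
  exact Finset.sum_congr rfl fun b _ => by ring

theorem FiberBound.add_fiberConv {f g : G → ℂ} {N M : ℕ} (hf : FiberBound f N)
    (hg : FiberBound g M) {x : G} (ξ : Fiber x → ℂ) :
    fiberConv x (f + g) ξ = fiberConv x f ξ + fiberConv x g ξ := by
  classical
  ext a
  set R := (hf.finite_row a).toFinset ∪ (hg.finite_row a).toFinset with hRdef
  have hRf : ∀ b : Fiber x, f (mul a.1 (inv b.1)) ≠ 0 → b ∈ R := fun b hb => by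
    rw [hRdef, Finset.mem_union]; left; simpa using hb
  have hRg : ∀ b : Fiber x, g (mul a.1 (inv b.1)) ≠ 0 → b ∈ R := fun b hb => by
    rw [hRdef, Finset.mem_union]; right; simpa using hb
  have hR : ∀ b : Fiber x, (f + g) (mul a.1 (inv b.1)) ≠ 0 → b ∈ R := fun b hb => by
    by_contra hcon
    refine hb ?_
    rw [Pi.add_apply, not_not.1 (mt (hRf b) hcon), not_not.1 (mt (hRg b) hcon), add_zero]
  rw [Pi.add_apply, fiberConv_eq_sum hR, fiberConv_eq_sum hRf, fiberConv_eq_sum hRg,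
    ← Finset.sum_add_distrib]
  exact Finset.sum_congr rfl fun b _ => by rw [Pi.add_apply, add_mul]

theorem smul_fiberConv (c : ℂ) (f : G → ℂ) {x : G} (ξ : Fiber x → ℂ) :
    fiberConv x (c • f) ξ = c • fiberConv x f ξ := by
  ext a
  simp only [fiberConv, Pi.smul_apply, smul_finsum]
  exact finsum_congr fun b => by rw [smul_mul_assoc]

variable [IsEtale G]

theorem memℓp_fiberConv (p : ℝ≥0∞) [Fact (1 ≤ p)] (x : G) (f : C_c(G, ℂ)) (ξ : EllP p (Fiber x)) :
    Memℓp (fiberConv x f ξ) p := by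
  obtain ⟨N, hN⟩ := exists_fiberBound f
  obtain ⟨C, hC0, hC⟩ := exists_norm_bound f
  exact schur_memℓp (A := fun a b : Fiber x => f (mul a.1 (inv b.1))) hN.row
    (fun _ _ => hC _) hC0 hN.col p ξ

/-- The left regular representation `π_x` on `ℓ^p(Gx)`, where `Gx` is the set of arrows with
domain `x`: the operator `π_x(f)` is left convolution by `f`. -/
def regRep (p : ℝ≥0∞) [Fact (1 ≤ p)] (x : units G) (f : C_c(G, ℂ)) :
    EllP p (Fiber x.1) →L[ℂ] EllP p (Fiber x.1) :=
  LinearMap.mkContinuousOfExistsBound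
    { toFun := fun ξ => ⟨fiberConv x.1 f ξ, memℓp_fiberConv p x.1 f ξ⟩
      map_add' := fun ξ η => by
        obtain ⟨N, hN⟩ := exists_fiberBound f
        exact lp.ext (hN.fiberConv_add ξ η)
      map_smul' := fun c ξ => by
        obtain ⟨N, hN⟩ := exists_fiberBound f
        exact lp.ext (hN.fiberConv_smul c ξ) }
    (by
      obtain ⟨N, hN⟩ := exists_fiberBound f
      obtain ⟨C, hC0, hC⟩ := exists_norm_bound f
      exact ⟨N * C, fun ξ => schur_norm_le (A := fun a b : Fiber x.1 => f (mul a.1 (inv b.1)))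
        hN.row (fun _ _ => hC _) hC0 hN.col p ξ _ fun _ => rfl⟩)

theorem coe_regRep (p : ℝ≥0∞) [Fact (1 ≤ p)] (x : units G) (f : C_c(G, ℂ))
    (ξ : EllP p (Fiber x.1)) : ⇑(regRep p x f ξ) = fiberConv x.1 f ξ := rfl

theorem exists_norm_regRep_le (p : ℝ≥0∞) [Fact (1 ≤ p)] (f : C_c(G, ℂ)) :
    ∃ B : ℝ, 0 ≤ B ∧ ∀ x : units G, ‖regRep p x f‖ ≤ B := by
  obtain ⟨N, hN⟩ := exists_fiberBound f
  obtain ⟨C, hC0, hC⟩ := exists_norm_bound f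
  refine ⟨N * C, by positivity, fun x => ContinuousLinearMap.opNorm_le_bound _ (by positivity)
    fun ξ => ?_⟩
  exact schur_norm_le (A := fun a b : Fiber x.1 => f (mul a.1 (inv b.1)))
        hN.row (fun _ _ => hC _) hC0 hN.col p ξ _ fun _ => rfl

theorem regRep_add (p : ℝ≥0∞) [Fact (1 ≤ p)] (x : units G) (f g : C_c(G, ℂ)) :
    regRep p x (f + g) = regRep p x f + regRep p x g := by
  obtain ⟨N, hN⟩ := exists_fiberBound f
  obtain ⟨M, hM⟩ := exists_fiberBound g
  ext1 ξ
  exact lp.ext (hN.add_fiberConv hM ξ)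

theorem regRep_smul (p : ℝ≥0∞) [Fact (1 ≤ p)] (x : units G) (c : ℂ) (f : C_c(G, ℂ)) :
    regRep p x (c • f) = c • regRep p x f := by
  ext1 ξ
  exact lp.ext (smul_fiberConv c f ξ)

theorem regRep_convC [T2Space G] (p : ℝ≥0∞) [Fact (1 ≤ p)] (x : units G) (f g : C_c(G, ℂ)) :
    regRep p x (convC f g) = regRep p x f * regRep p x g := by
  obtain ⟨N, hN⟩ := exists_fiberBound f
  obtain ⟨M, hM⟩ := exists_fiberBound g
  ext1 ξ
  exact lp.ext (fiberConv_fiberConv hN hM ξ).symm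

theorem norm_apply_le_regRep (p : ℝ≥0∞) [Fact (1 ≤ p)] (f : C_c(G, ℂ)) (x : units G)
    (a : Fiber x.1) : ‖f a.1‖ ≤ ‖regRep p x f‖ := by
  classical
  have hp0 : 0 < p := zero_lt_one.trans_le Fact.out
  let u : Fiber x.1 := ⟨x.1, dom_of_mem_units x.2⟩
  have h1 : regRep p x f (lp.single p u (1 : ℂ)) a = f a.1 := by
    rw [coe_regRep, fiberConv, finsum_eq_single _ u]
    · rw [lp.single_apply_self, mul_one]
      congr 1
      have h0 : mul a.1 (inv x.1) = mul a.1 (dom a.1) := by rw [← x.2.1, a.2]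
      exact h0.trans (mul_dom_self a.1)
    · intro b hb
      rw [lp.single_apply_ne p u 1 hb, mul_zero]
  have h2 := (regRep p x f).le_opNorm (lp.single p u (1 : ℂ))
  rw [lp.norm_single (E := fun _ : Fiber x.1 => ℂ) hp0, norm_one, mul_one] at h2
  rw [← h1]
  exact (lp.norm_apply_le_norm hp0.ne' _ _).trans h2

end RegularRepresentation

/-! ### The reduced groupoid `L^p`-operator algebra -/

section ReducedAlgebra

open TopologicalGroupoid

variable (p : ℝ≥0∞) [Fact (1 ≤ p)] (G : Type*) [TopologicalSpace G] [TopologicalGroupoid G]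

/-- The convolution algebra `C_c(G)`; the index `p` selects the norm it is given below. -/
def ConvAlg (_p : ℝ≥0∞) (G : Type*) [TopologicalSpace G] : Type _ := C_c(G, ℂ)

instance (p : ℝ≥0∞) (G : Type*) [TopologicalSpace G] : AddCommGroup (ConvAlg p G) :=
  inferInstanceAs (AddCommGroup C_c(G, ℂ))

instance (p : ℝ≥0∞) (G : Type*) [TopologicalSpace G] : Module ℂ (ConvAlg p G) :=
  inferInstanceAs (Module ℂ C_c(G, ℂ))

instance (p : ℝ≥0∞) (G : Type*) [TopologicalSpace G] : FunLike (ConvAlg p G) G ℂ :=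
  inferInstanceAs (FunLike C_c(G, ℂ) G ℂ)

namespace ConvAlg

variable {p G}

@[ext]
theorem ext {f g : ConvAlg p G} (h : ∀ a, f a = g a) : f = g := DFunLike.ext _ _ h

/-- An element of the convolution algebra as a compactly supported continuous function. -/
def toC (f : ConvAlg p G) : C_c(G, ℂ) := f

/-- The norm `‖f‖_λ = sup_x ‖π_x(f)‖`. -/
instance [IsEtale G] : Norm (ConvAlg p G) := ⟨fun f => ⨆ x : units G, ‖regRep p x f.toC‖⟩

theorem norm_def [IsEtale G] (f : ConvAlg p G) : ‖f‖ = ⨆ x : units G, ‖regRep p x f.toC‖ := rfl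

theorem norm_regRep_le [IsEtale G] (f : ConvAlg p G) (x : units G) :
    ‖regRep p x f.toC‖ ≤ ‖f‖ := by
  obtain ⟨B, _, hB⟩ := exists_norm_regRep_le p f.toC
  exact le_ciSup (f := fun x : units G => ‖regRep p x f.toC‖)
    ⟨B, by rintro _ ⟨y, rfl⟩; exact hB y⟩ x

theorem norm_le_of_regRep [IsEtale G] (f : ConvAlg p G) {B : ℝ} (hB : 0 ≤ B)
    (h : ∀ x : units G, ‖regRep p x f.toC‖ ≤ B) : ‖f‖ ≤ B :=
  Real.iSup_le h hB

theorem norm_nonneg' [IsEtale G] (f : ConvAlg p G) : 0 ≤ ‖f‖ :=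
  Real.iSup_nonneg fun _ => norm_nonneg _

theorem norm_apply_le [IsEtale G] (f : ConvAlg p G) (a : G) : ‖f a‖ ≤ ‖f‖ :=
  (norm_apply_le_regRep p f.toC (domMap a) ⟨a, rfl⟩).trans (norm_regRep_le f _)

variable [T2Space G] [IsEtale G] [CompactSpace (units G)]

open scoped Classical in
/-- A continuous function on the compact (and open and closed) unit space, extended by zero to
all arrows. -/
def ofUnits (f : C(units G, ℂ)) : ConvAlg p G :=
  show C_c(G, ℂ) from
  { toFun := fun a => if h : a ∈ units G then f ⟨a, h⟩ else 0
    continuous_toFun := by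
      rw [continuous_iff_continuousAt]
      intro a
      by_cases ha : a ∈ units G
      · have := (isOpen_units (G := G)).isOpenEmbedding_subtypeVal.continuousAt_iff (x := ⟨a, ha⟩)
          (g := fun a => if h : a ∈ units G then f ⟨a, h⟩ else 0)
        refine this.1 ?_
        have h2 : ((fun a => if h : a ∈ units G then f ⟨a, h⟩ else 0) ∘ Subtype.val :
            units G → ℂ) = f := by
          ext b
          simp
        rw [h2]
        exact f.continuous.continuousAt
      · refine ContinuousAt.congr (f := fun _ => (0 : ℂ)) continuousAt_const ?_
        filter_upwards [isClosed_units.isOpen_compl.mem_nhds ha] with b hb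
        have hb' : b ∉ units G := hb
        rw [dif_neg hb']
    hasCompactSupport' := by
      refine HasCompactSupport.intro (isCompact_iff_compactSpace.2 ‹CompactSpace (units G)›)
        fun a ha => dif_neg ha }

theorem ofUnits_apply (f : C(units G, ℂ)) (u : units G) : (ofUnits f : ConvAlg p G) u.1 = f u :=
  dif_pos u.2

theorem ofUnits_apply_of_notMem (f : C(units G, ℂ)) {a : G} (h : a ∉ units G) :
    (ofUnits f : ConvAlg p G) a = 0 :=
  dif_neg h

instance : Mul (ConvAlg p G) := ⟨fun f g => convC f.toC g.toC⟩

/-- The unit of the convolution algebra is the characteristic function of the unit space. -/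
instance : One (ConvAlg p G) := ⟨ofUnits 1⟩

theorem mul_def (f g : ConvAlg p G) (a : G) : (f * g) a = conv f g a := rfl

theorem one_def : (1 : ConvAlg p G) = ofUnits 1 := rfl

theorem ofUnits_mul_apply (f : C(units G, ℂ)) (g : ConvAlg p G) (a : G) :
    ((ofUnits f : ConvAlg p G) * g) a = f (ranMap a) * g a := by
  rw [mul_def, conv, finsum_eq_single _ ⟨a, rfl⟩]
  · congr 1
    exact ofUnits_apply f (ranMap a)
  · rintro ⟨b, hb⟩ hne
    rw [ofUnits_apply_of_notMem, zero_mul]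
    intro hu
    refine hne (Subtype.ext ?_)
    have h1 := mul_inv_mul hb
    have h2 : mul a (inv b) = ran b := by
      rw [← dom_mul_inv hb, dom_of_mem_units hu]
    rwa [h2, ran_mul_self] at h1

theorem mul_ofUnits_apply (f : C(units G, ℂ)) (g : ConvAlg p G) (a : G) :
    (g * (ofUnits f : ConvAlg p G)) a = g a * f (domMap a) := by
  rw [mul_def, conv, finsum_eq_single _ ⟨dom a, dom_of_mem_units (dom_mem_units a)⟩]
  · congr 1
    · congr 1
      change mul a (inv (dom a)) = a
      rw [← (dom_mem_units a).1, mul_dom_self]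
    · exact ofUnits_apply f (domMap a)
  · rintro ⟨b, hb⟩ hne
    rw [ofUnits_apply_of_notMem f (a := b), mul_zero]
    intro hu
    exact hne (Subtype.ext ((dom_of_mem_units hu).symm.trans hb))

instance : Ring (ConvAlg p G) where
  __ := (inferInstance : AddCommGroup (ConvAlg p G))
  __ := (inferInstance : Mul (ConvAlg p G))
  __ := (inferInstance : One (ConvAlg p G))
  left_distrib f g h := by
    ext a
    obtain ⟨N, hN⟩ := exists_fiberBound f.toC
    exact congrFun (hN.fiberConv_add (x := dom a) (fun b => g b.1) (fun b => h b.1)) ⟨a, rfl⟩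
  right_distrib f g h := by
    ext a
    obtain ⟨N, hN⟩ := exists_fiberBound f.toC
    obtain ⟨M, hM⟩ := exists_fiberBound g.toC
    exact congrFun (hN.add_fiberConv hM (x := dom a) (fun b => h b.1)) ⟨a, rfl⟩
  zero_mul f := by
    ext a
    exact finsum_eq_zero_of_forall_eq_zero fun b => zero_mul _
  mul_zero f := by
    ext a
    exact finsum_eq_zero_of_forall_eq_zero fun b => mul_zero _
  mul_assoc f g h := by
    ext a
    obtain ⟨N, hN⟩ := exists_fiberBound f.toC
    obtain ⟨M, hM⟩ := exists_fiberBound g.toC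
    exact congrFun (conv_assoc hN hM h) a
  one_mul f := by
    ext a
    rw [one_def, ofUnits_mul_apply]
    exact one_mul _
  mul_one f := by
    ext a
    rw [one_def, mul_ofUnits_apply]
    exact mul_one _

instance : Algebra ℂ (ConvAlg p G) :=
  Algebra.ofModule
    (fun c f g => by
      ext a
      exact congrFun (smul_fiberConv c f (x := dom a) (fun b => g b.1)) ⟨a, rfl⟩)
    (fun c f g => by
      ext a
      obtain ⟨N, hN⟩ := exists_fiberBound f.toC
      exact congrFun (hN.fiberConv_smul (x := dom a) c (fun b => g b.1)) ⟨a, rfl⟩)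

variable (p G) in
/-- `‖·‖_λ` is a submultiplicative norm on the convolution algebra. -/
def ringNorm : RingNorm (ConvAlg p G) where
  toFun f := ‖f‖
  map_zero' := by
    refine le_antisymm (norm_le_of_regRep _ le_rfl fun x => ?_) (norm_nonneg' _)
    have : regRep p x (toC (0 : ConvAlg p G)) = 0 := by
      have := regRep_smul p x 0 (0 : C_c(G, ℂ))
      rw [zero_smul, zero_smul] at this
      exact this
    rw [this, norm_zero]
  add_le' f g := by
    refine norm_le_of_regRep _ (add_nonneg (norm_nonneg' _) (norm_nonneg' _)) fun x => ?_
    have := regRep_add p x f.toC g.toC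
    change ‖regRep p x (f.toC + g.toC)‖ ≤ _
    rw [this]
    exact (norm_add_le _ _).trans (add_le_add (norm_regRep_le f x) (norm_regRep_le g x))
  neg' f := by
    change (⨆ x : units G, ‖regRep p x (-f.toC)‖) = ⨆ x : units G, ‖regRep p x f.toC‖
    congr 1
    ext x
    have := regRep_smul p x (-1) f.toC
    rw [show (-1 : ℂ) • f.toC = -f.toC by ext; simp, neg_one_smul] at this
    rw [this, norm_neg]
  mul_le' f g := by
    refine norm_le_of_regRep _ (mul_nonneg (norm_nonneg' _) (norm_nonneg' _)) fun x => ?_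
    change ‖regRep p x (convC f.toC g.toC)‖ ≤ _
    rw [regRep_convC]
    exact (norm_mul_le _ _).trans (mul_le_mul (norm_regRep_le f x) (norm_regRep_le g x)
      (norm_nonneg _) (norm_nonneg' _))
  eq_zero_of_map_eq_zero' f hf := by
    ext a
    have := norm_apply_le f a
    rw [show ‖f‖ = 0 from hf] at this
    exact norm_le_zero_iff.1 this

instance : NormedRing (ConvAlg p G) where
  __ := (inferInstance : Ring (ConvAlg p G))
  __ := (inferInstance : Norm (ConvAlg p G))
  __ := (ringNorm p G).toNormedRing

instance : NormedAlgebra ℂ (ConvAlg p G) where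
  norm_smul_le c f := by
    refine norm_le_of_regRep _ (mul_nonneg (norm_nonneg _) (norm_nonneg' _)) fun x => ?_
    change ‖regRep p x (c • f.toC)‖ ≤ _
    rw [regRep_smul, norm_smul]
    exact mul_le_mul_of_nonneg_left (norm_regRep_le f x) (norm_nonneg _)

theorem ofUnits_mul (f g : C(units G, ℂ)) :
    (ofUnits (f * g) : ConvAlg p G) = ofUnits f * ofUnits g := by
  ext a
  rw [ofUnits_mul_apply]
  by_cases ha : a ∈ units G
  · rw [ofUnits_apply _ ⟨a, ha⟩, ofUnits_apply _ ⟨a, ha⟩,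
      show ranMap a = ⟨a, ha⟩ from Subtype.ext (ran_of_mem_units ha)]
    rfl
  · rw [ofUnits_apply_of_notMem _ ha, ofUnits_apply_of_notMem _ ha, mul_zero]

theorem ofUnits_add (f g : C(units G, ℂ)) :
    (ofUnits (f + g) : ConvAlg p G) = ofUnits f + ofUnits g := by
  ext a
  change _ = (ofUnits f : ConvAlg p G) a + (ofUnits g : ConvAlg p G) a
  by_cases ha : a ∈ units G
  · rw [ofUnits_apply _ ⟨a, ha⟩, ofUnits_apply _ ⟨a, ha⟩, ofUnits_apply _ ⟨a, ha⟩]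
    rfl
  · rw [ofUnits_apply_of_notMem _ ha, ofUnits_apply_of_notMem _ ha,
      ofUnits_apply_of_notMem _ ha, add_zero]

theorem ofUnits_smul (c : ℂ) (f : C(units G, ℂ)) :
    (ofUnits (c • f) : ConvAlg p G) = c • ofUnits f := by
  ext a
  change _ = c • (ofUnits f : ConvAlg p G) a
  by_cases ha : a ∈ units G
  · rw [ofUnits_apply _ ⟨a, ha⟩, ofUnits_apply _ ⟨a, ha⟩]
    rfl
  · rw [ofUnits_apply_of_notMem _ ha, ofUnits_apply_of_notMem _ ha, smul_zero]

/-- Extension by zero as a homomorphism of algebras. -/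
def ofUnitsHom : C(units G, ℂ) →ₐ[ℂ] ConvAlg p G :=
  AlgHom.ofLinearMap
    { toFun := ofUnits
      map_add' := ofUnits_add
      map_smul' := ofUnits_smul } rfl ofUnits_mul

end ConvAlg

variable [T2Space G] [IsEtale G] [CompactSpace (units G)]

/-- The reduced groupoid `L^p`-operator algebra `F^p_λ(G)`: the completion of the convolution
algebra `C_c(G)` in the norm `‖f‖_λ = sup_x ‖π_x(f)‖`. -/
def ReducedAlgebra : Type _ := UniformSpace.Completion (ConvAlg p G)

namespace ReducedAlgebra

instance : NormedRing (ReducedAlgebra p G) :=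
  inferInstanceAs (NormedRing (UniformSpace.Completion (ConvAlg p G)))

instance : CompleteSpace (ReducedAlgebra p G) :=
  inferInstanceAs (CompleteSpace (UniformSpace.Completion (ConvAlg p G)))

instance : Algebra ℂ (ReducedAlgebra p G) :=
  inferInstanceAs (Algebra ℂ (UniformSpace.Completion (ConvAlg p G)))

instance : NormedAlgebra ℂ (ReducedAlgebra p G) where
  norm_smul_le := _root_.norm_smul_le (α := ℂ) (β := UniformSpace.Completion (ConvAlg p G))

/-- The canonical homomorphism from `C_c(G)` to its completion `F^p_λ(G)`. -/
def ofConvAlg : ConvAlg p G →ₐ[ℂ] ReducedAlgebra p G where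
  __ := (UniformSpace.Completion.coeRingHom :
    ConvAlg p G →+* UniformSpace.Completion (ConvAlg p G))
  commutes' _ := rfl

/-- The canonical homomorphism `C(G⁽⁰⁾) → F^p_λ(G)`: extend a continuous function on the unit
space by zero to an element of `C_c(G)`, and regard it as an element of the completion. -/
def ofUnits : C(units G, ℂ) →ₐ[ℂ] ReducedAlgebra p G :=
  (ofConvAlg p G).comp ConvAlg.ofUnitsHom

end ReducedAlgebra

end ReducedAlgebra

/-! ### The `C^*`-core -/

section Core

variable {A : Type*} [NormedRing A] [NormedAlgebra ℂ A]

/-- An element `a` of a unital complex Banach algebra is hermitian if `‖exp(ita)‖ = 1` for all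
real `t`. -/
def IsHermitianElement (a : A) : Prop :=
  ∀ t : ℝ, ‖NormedSpace.exp ((Complex.I * t) • a)‖ = 1

variable (A) in
/-- The `C^*`-core `A_h + i A_h` of a unital `L^p`-operator algebra `A`, where `A_h` is the set of
hermitian elements of `A`. -/
def cstarCore : Set A :=
  {a | ∃ h k : A, IsHermitianElement h ∧ IsHermitianElement k ∧ a = h + Complex.I • k}

end Core

end LpGroupoid

/-!
For `p ≠ 2` the defect in the `p`-parallelogram law of two scalars never has the sign opposite to
`p - 2`, and it vanishes only if one of the scalars is zero. Summing over coordinates, two vectors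
of `ℓ^p` satisfy the law exactly when their supports are disjoint, so every isometry of `ℓ^p`
preserves disjointness of supports (Lamperti). If `T` is hermitian, this applies to the isometries
`exp (itT)`, which are close to the identity for small `t`; differentiating at `t = 0` shows that
`T` is diagonal. Hence `π_x(a)` is diagonal for every unit `x` and every hermitian element `a` of
the reduced algebra. Restriction of functions to the unit space extends to a contraction onto
`C(G⁽⁰⁾)`, which reads off the diagonal of `π_x(a)` for every `x`, so `a` is the image of its
restriction. Conversely, contractive unital homomorphisms preserve hermitian elements, and
self-adjoint functions are hermitian in `C(G⁽⁰⁾)`.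
-/

namespace LpGroupoid

section ParallelogramDefect

theorem add_lt_map_add_of_strictConvexOn {g : ℝ → ℝ} (hg : StrictConvexOn ℝ (Set.Ici 0) g)
    (hg0 : g 0 ≤ 0) {x y : ℝ} (hx : 0 < x) (hy : 0 < y) : g x + g y < g (x + y) := by
  have hxy : 0 < x + y := add_pos hx hy
  have lt_mul_map : ∀ z, 0 < z → z < x + y → g z < z / (x + y) * g (x + y) := fun z hz hlt => by
    have h := hg.2 (Set.mem_Ici.2 hxy.le) Set.self_mem_Ici hxy.ne' (div_pos hz hxy)
      (sub_pos.2 ((div_lt_one hxy).2 hlt)) (add_sub_cancel _ _)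
    simp only [smul_eq_mul, mul_zero, add_zero, div_mul_cancel₀ z hxy.ne'] at h
    exact h.trans_le <| add_le_of_nonpos_right <|
      mul_nonpos_of_nonneg_of_nonpos (sub_pos.2 ((div_lt_one hxy).2 hlt)).le hg0
  calc g x + g y < x / (x + y) * g (x + y) + y / (x + y) * g (x + y) :=
        add_lt_add (lt_mul_map x hx (by linarith)) (lt_mul_map y hy (by linarith))
    _ = g (x + y) := by field_simp

/-- The defect of the pair `x`, `y` in the parallelogram law with exponent `q` in place of `2`. -/
def parallelogramDefect {E : Type*} [SeminormedAddCommGroup E] (q : ℝ) (x y : E) : ℝ :=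
  ‖x + y‖ ^ q + ‖x - y‖ ^ q - 2 * (‖x‖ ^ q + ‖y‖ ^ q)

theorem parallelogramDefect_eq_zero_of_eq_zero_or {E : Type*} [NormedAddCommGroup E] {q : ℝ}
    (hq : 0 < q) {x y : E} (h : x = 0 ∨ y = 0) : parallelogramDefect q x y = 0 := by
  rcases h with rfl | rfl <;>
    simp only [parallelogramDefect, zero_add, zero_sub, add_zero, sub_zero, norm_neg, norm_zero,
      Real.zero_rpow hq.ne'] <;>
    ring

theorem parallelogramDefect_map {E F Φ : Type*} [SeminormedAddCommGroup E]
    [SeminormedAddCommGroup F] [FunLike Φ E F] [AddMonoidHomClass Φ E F] (U : Φ)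
    (hU : ∀ x, ‖U x‖ = ‖x‖) (q : ℝ) (x y : E) :
    parallelogramDefect q (U x) (U y) = parallelogramDefect q x y := by
  simp only [parallelogramDefect, ← map_add, ← map_sub, hU]

variable (𝕜 : Type*) [RCLike 𝕜]

section InnerProductSpace

variable {E : Type*} [NormedAddCommGroup E] [InnerProductSpace 𝕜 E]

include 𝕜 in
theorem parallelogram_lt_of_strictConvexOn {g : ℝ → ℝ} (hg : StrictConvexOn ℝ (Set.Ici 0) g)
    (hg0 : g 0 ≤ 0) {x y : E} (hx : x ≠ 0) (hy : y ≠ 0) :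
    2 * (g (‖x‖ ^ 2) + g (‖y‖ ^ 2)) < g (‖x + y‖ ^ 2) + g (‖x - y‖ ^ 2) := by
  have superadditive : g (‖x‖ ^ 2) + g (‖y‖ ^ 2) < g (‖x‖ ^ 2 + ‖y‖ ^ 2) :=
    add_lt_map_add_of_strictConvexOn hg hg0 (by positivity) (by positivity)
  have parallelogram : (1 / 2 : ℝ) • ‖x + y‖ ^ 2 + (1 / 2 : ℝ) • ‖x - y‖ ^ 2 =
      ‖x‖ ^ 2 + ‖y‖ ^ 2 := by
    have h := parallelogram_law_with_norm 𝕜 x y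
    simp only [smul_eq_mul]
    linarith
  have midpoint := hg.convexOn.2 (Set.mem_Ici.2 (sq_nonneg ‖x + y‖))
    (Set.mem_Ici.2 (sq_nonneg ‖x - y‖)) one_half_pos.le one_half_pos.le (add_halves (1 : ℝ))
  rw [parallelogram, smul_eq_mul, smul_eq_mul] at midpoint
  linarith

include 𝕜 in
theorem mul_parallelogramDefect_pos {q : ℝ} (hq : 0 < q) (hq2 : q ≠ 2) {x y : E} (hx : x ≠ 0)
    (hy : y ≠ 0) : 0 < (q - 2) * parallelogramDefect q x y := by
  have rpow_eq : ∀ z : E, ‖z‖ ^ q = (‖z‖ ^ 2) ^ (q / 2) := fun z => by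
    rw [← Real.rpow_natCast_mul (norm_nonneg z), Nat.cast_ofNat, mul_div_cancel₀ q two_ne_zero]
  have zero_rpow : (0 : ℝ) ^ (q / 2) = 0 := Real.zero_rpow (half_pos hq).ne'
  rw [parallelogramDefect]
  simp only [rpow_eq]
  rcases lt_or_gt_of_ne hq2 with hlt | hgt
  · have h := parallelogram_lt_of_strictConvexOn 𝕜
      (Real.strictConcaveOn_rpow (half_pos hq) (by linarith)).neg (by simp [zero_rpow]) hx hy
    simp only [Pi.neg_apply] at h
    exact mul_pos_of_neg_of_neg (by linarith) (by linarith)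
  · have h := parallelogram_lt_of_strictConvexOn 𝕜
      (strictConvexOn_rpow (by linarith : 1 < q / 2)) zero_rpow.le hx hy
    exact mul_pos (by linarith) (by linarith)

include 𝕜 in
theorem mul_parallelogramDefect_nonneg {q : ℝ} (hq : 0 < q) (x y : E) :
    0 ≤ (q - 2) * parallelogramDefect q x y := by
  rcases eq_or_ne q 2 with rfl | hq2
  · rw [sub_self, zero_mul]
  by_cases h : x = 0 ∨ y = 0
  · rw [parallelogramDefect_eq_zero_of_eq_zero_or hq h, mul_zero]
  · push Not at h
    exact (mul_parallelogramDefect_pos 𝕜 hq hq2 h.1 h.2).le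

include 𝕜 in
theorem parallelogramDefect_eq_zero_iff {q : ℝ} (hq : 0 < q) (hq2 : q ≠ 2) {x y : E} :
    parallelogramDefect q x y = 0 ↔ x = 0 ∨ y = 0 := by
  refine ⟨fun h => ?_, parallelogramDefect_eq_zero_of_eq_zero_or hq⟩
  by_contra! hne
  simpa [h] using mul_parallelogramDefect_pos 𝕜 hq hq2 hne.1 hne.2

end InnerProductSpace

section Lp

variable {p : ℝ≥0∞} [Fact (1 ≤ p)] {S : Type*} {E : S → Type*} [∀ s, NormedAddCommGroup (E s)]

theorem toReal_pos_of_one_le (hp : p ≠ ∞) : 0 < p.toReal :=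
  ENNReal.toReal_pos (zero_lt_one.trans_le (Fact.out : 1 ≤ p)).ne' hp

theorem hasSum_parallelogramDefect (hp : p ≠ ∞) (ξ η : lp E p) :
    HasSum (fun s => parallelogramDefect p.toReal (ξ s) (η s))
      (parallelogramDefect p.toReal ξ η) := by
  have hasSum_norm (ζ : lp E p) := lp.hasSum_norm (toReal_pos_of_one_le hp) ζ
  exact ((hasSum_norm (ξ + η)).add (hasSum_norm (ξ - η))).sub
    (((hasSum_norm ξ).add (hasSum_norm η)).mul_left 2)

variable [∀ s, InnerProductSpace 𝕜 (E s)]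

include 𝕜 in
theorem lp_parallelogramDefect_eq_zero_iff (hp : p ≠ ∞) (hp2 : p ≠ 2) {ξ η : lp E p} :
    parallelogramDefect p.toReal ξ η = 0 ↔ ∀ s, ξ s = 0 ∨ η s = 0 := by
  have hq : 0 < p.toReal := toReal_pos_of_one_le hp
  have hq2 : p.toReal ≠ 2 := fun h => hp2 <| by
    rw [← ENNReal.ofReal_toReal hp, h, ENNReal.ofReal_ofNat]
  have hsum := (hasSum_parallelogramDefect hp ξ η).mul_left (p.toReal - 2)
  simp only [← parallelogramDefect_eq_zero_iff 𝕜 hq hq2]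
  constructor
  · intro h s
    rw [h, mul_zero, hasSum_zero_iff_of_nonneg
      fun s => mul_parallelogramDefect_nonneg 𝕜 hq (ξ s) (η s)] at hsum
    exact (mul_eq_zero.1 (congrFun hsum s)).resolve_left (sub_ne_zero.2 hq2)
  · intro h
    exact (hasSum_parallelogramDefect hp ξ η).unique (by simp only [h, hasSum_zero])

theorem apply_eq_zero_or_apply_eq_zero_of_linearIsometry {T : Type*} {F : T → Type*}
    [∀ t, NormedAddCommGroup (F t)] [∀ t, InnerProductSpace 𝕜 (F t)] (hp : p ≠ ∞) (hp2 : p ≠ 2)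
    (U : lp E p →ₗᵢ[𝕜] lp F p) {ξ η : lp E p} (h : ∀ s, ξ s = 0 ∨ η s = 0) (t : T) :
    U ξ t = 0 ∨ U η t = 0 := by
  rw [← lp_parallelogramDefect_eq_zero_iff 𝕜 hp hp2] at h
  refine (lp_parallelogramDefect_eq_zero_iff 𝕜 hp hp2).1 ?_ t
  rw [parallelogramDefect_map U U.norm_map, h]

end Lp

end ParallelogramDefect

section Hermitian

open Complex (I I_ne_zero coe_smul conj_ofReal ofReal_neg ofReal_zero)
open NormedSpace

theorem cstarCore_subset {A : Type*} [NormedRing A] [NormedAlgebra ℂ A] {V : Submodule ℂ A}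
    (hV : ∀ a, IsHermitianElement a → a ∈ V) : cstarCore A ⊆ V := by
  rintro _ ⟨h, k, hh, hk, rfl⟩
  exact V.add_mem (hV h hh) (V.smul_mem I (hV k hk))

section BanachAlgebra

variable {A B : Type*} [NormedRing A] [NormedAlgebra ℂ A] [CompleteSpace A] [NormedRing B]
  [NormedAlgebra ℂ B] [CompleteSpace B]

theorem exp_neg_mul_exp_eq_one (a : A) : exp (-a) * exp a = 1 := by
  let +nondep : NormedAlgebra ℚ A := .restrictScalars ℚ ℂ A
  rw [← exp_add_of_commute (Commute.refl a).neg_left, neg_add_cancel, exp_zero]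

theorem hasDerivAt_exp_I_mul_smul_zero (a : A) :
    HasDerivAt (fun t : ℝ => exp ((I * t) • a)) (I • a) 0 := by
  have h := hasDerivAt_exp_smul_const (𝕂 := ℝ) (I • a) (0 : ℝ)
  rw [zero_smul, exp_zero, one_mul] at h
  refine h.congr_of_eventuallyEq (.of_forall fun t => ?_)
  simp only [mul_comm I, mul_smul, coe_smul]

theorem isHermitianElement_of_norm_exp_le [NormOneClass A] {a : A}
    (h : ∀ t : ℝ, ‖exp ((I * t) • a)‖ ≤ 1) : IsHermitianElement a := fun t => by
  refine le_antisymm (h t) ?_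
  have h_neg : ‖exp (-((I * t) • a))‖ ≤ 1 := by
    simpa only [ofReal_neg, mul_neg, neg_smul] using h (-t)
  calc (1 : ℝ) = ‖exp (-((I * t) • a)) * exp ((I * t) • a)‖ := by
        rw [exp_neg_mul_exp_eq_one, norm_one]
    _ ≤ ‖exp (-((I * t) • a))‖ * ‖exp ((I * t) • a)‖ := norm_mul_le _ _
    _ ≤ ‖exp ((I * t) • a)‖ := mul_le_of_le_one_left (norm_nonneg _) h_neg

theorem IsHermitianElement.map {Φ : Type*} [FunLike Φ A B] [AlgHomClass Φ ℂ A B] [NormOneClass B]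
    {a : A} (ha : IsHermitianElement a) (φ : Φ) (hφ : ∀ a, ‖φ a‖ ≤ ‖a‖) :
    IsHermitianElement (φ a) := by
  let +nondep : NormedAlgebra ℚ A := .restrictScalars ℚ ℂ A
  let +nondep : NormedAlgebra ℚ B := .restrictScalars ℚ ℂ B
  have hcont : Continuous φ := AddMonoidHomClass.continuous_of_bound φ 1 (by simpa using hφ)
  refine isHermitianElement_of_norm_exp_le fun t => ?_
  rw [← map_smul, ← map_exp φ hcont, ← ha t]
  exact hφ _

end BanachAlgebra

section CStarAlgebra

variable {A B : Type*} [CStarAlgebra A] [NormedRing B] [NormedAlgebra ℂ B] [CompleteSpace B]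

theorem isHermitianElement_of_isSelfAdjoint [Nontrivial A] {a : A} (ha : IsSelfAdjoint a) :
    IsHermitianElement a := fun t => by
  have hta : IsSelfAdjoint ((t : ℂ) • a) := IsSelfAdjoint.smul (conj_ofReal t) ha
  rw [mul_smul]
  exact CStarRing.norm_coe_unitary (selfAdjoint.expUnitary ⟨(t : ℂ) • a, hta⟩)

theorem range_subset_cstarCore {Φ : Type*} [FunLike Φ A B] [AlgHomClass Φ ℂ A B] [Nontrivial A]
    [NormOneClass B] (φ : Φ) (hφ : ∀ a, ‖φ a‖ ≤ ‖a‖) : Set.range φ ⊆ cstarCore B := by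
  rintro _ ⟨a, rfl⟩
  refine ⟨φ (realPart a), φ (imaginaryPart a),
    (isHermitianElement_of_isSelfAdjoint (realPart a).2).map φ hφ,
    (isHermitianElement_of_isSelfAdjoint (imaginaryPart a).2).map φ hφ, ?_⟩
  rw [← map_smul, ← map_add, realPart_add_I_smul_imaginaryPart]

end CStarAlgebra

section Operators

variable {E : Type*} [NormedAddCommGroup E] [NormedSpace ℂ E] [CompleteSpace E] {T : E →L[ℂ] E}

/-- The isometry `exp (itT)` of the one-parameter group generated by a hermitian operator `T`. -/
def IsHermitianElement.expIsometry (hT : IsHermitianElement T) (t : ℝ) : E →ₗᵢ[ℂ] E where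
  toLinearMap := (exp ((I * t) • T)).toLinearMap
  norm_map' ξ := by
    have norm_exp_apply_le (r : ℝ) (ζ : E) : ‖exp ((I * r) • T) ζ‖ ≤ ‖ζ‖ := by
      simpa only [hT r, one_mul] using (exp ((I * r) • T)).le_opNorm ζ
    refine le_antisymm (norm_exp_apply_le t ξ) ?_
    have h := norm_exp_apply_le (-t) (exp ((I * t) • T) ξ)
    rwa [ofReal_neg, mul_neg, neg_smul, ← mul_apply_eq_comp,
      exp_neg_mul_exp_eq_one, one_apply_eq_self] at h

theorem IsHermitianElement.expIsometry_zero_apply (hT : IsHermitianElement T) (ξ : E) :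
    hT.expIsometry 0 ξ = ξ := by
  change exp ((I * ((0 : ℝ) : ℂ)) • T) ξ = ξ
  rw [ofReal_zero, mul_zero, zero_smul, exp_zero, one_apply_eq_self]

theorem IsHermitianElement.hasDerivAt_expIsometry_apply_zero (hT : IsHermitianElement T) (ξ : E) :
    HasDerivAt (fun t => hT.expIsometry t ξ) (I • T ξ) 0 :=
  ((ContinuousLinearMap.apply ℂ E ξ).restrictScalars ℝ).hasFDerivAt.comp_hasDerivAt 0
    (hasDerivAt_exp_I_mul_smul_zero T)

end Operators

section Lp

variable {p : ℝ≥0∞} [Fact (1 ≤ p)] {S : Type*} {E : S → Type*} [∀ s, NormedAddCommGroup (E s)]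
  [∀ s, InnerProductSpace ℂ (E s)] [∀ s, CompleteSpace (E s)]

theorem IsHermitianElement.apply_eq_zero_of_apply_eq_zero (hp : p ≠ ∞) (hp2 : p ≠ 2)
    {T : lp E p →L[ℂ] lp E p} (hT : IsHermitianElement T) {ξ : lp E p} {c : S} (hξ : ξ c = 0) :
    T ξ c = 0 := by
  classical
  by_contra hne
  let η : lp E p := lp.single p c (T ξ c)
  have hasDerivAt_exp_apply (ζ : lp E p) :
      HasDerivAt (fun t => hT.expIsometry t ζ c) (I • T ζ c) 0 :=
    ((lp.evalCLM ℂ E p c).restrictScalars ℝ).hasFDerivAt.comp_hasDerivAt 0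
      (hT.hasDerivAt_expIsometry_apply_zero ζ)
  have exp_apply_η_ne : ∀ᶠ t in 𝓝 (0 : ℝ), hT.expIsometry t η c ≠ 0 := by
    refine (hasDerivAt_exp_apply η).continuousAt.eventually_ne ?_
    rwa [hT.expIsometry_zero_apply, lp.single_apply_self]
  have disjoint_ξ_η (s : S) : ξ s = 0 ∨ η s = 0 := by
    rcases eq_or_ne s c with rfl | hs
    · exact .inl hξ
    · exact .inr (lp.single_apply_ne p c _ hs)
  have exp_apply_ξ_eq : (fun t => hT.expIsometry t ξ c) =ᶠ[𝓝 0] fun _ => 0 :=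
    exp_apply_η_ne.mono fun t =>
      (apply_eq_zero_or_apply_eq_zero_of_linearIsometry ℂ hp hp2 (hT.expIsometry t) disjoint_ξ_η
        c).resolve_right
  have hzero : I • T ξ c = 0 :=
    (hasDerivAt_exp_apply ξ).unique ((hasDerivAt_const 0 0).congr_of_eventuallyEq exp_apply_ξ_eq)
  exact hne ((smul_eq_zero.1 hzero).resolve_left I_ne_zero)

end Lp

end Hermitian

section ReducedAlgebra

open TopologicalGroupoid

variable {p : ℝ≥0∞} [Fact (1 ≤ p)] {G : Type*} [TopologicalSpace G] [TopologicalGroupoid G]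

instance [Nonempty G] : Nonempty (units G) := ‹Nonempty G›.map domMap

instance {x : units G} : Nontrivial (EllP p (Fiber x.1)) := by
  classical
  let u : Fiber x.1 := ⟨x.1, dom_of_mem_units x.2⟩
  refine ⟨lp.single p u (1 : ℂ), 0, fun h => one_ne_zero (α := ℂ) ?_⟩
  rw [← lp.single_apply_self (E := fun _ : Fiber x.1 => ℂ) p u 1, h, lp.coeFn_zero, Pi.zero_apply]

variable [IsEtale G]

theorem regRep_single_apply_self (x : units G) [DecidableEq (Fiber x.1)] (f : C_c(G, ℂ))
    (b : Fiber x.1) (z : ℂ) : regRep p x f (lp.single p b z) b = f (ran b.1) * z := by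
  have h_off : ∀ d, d ≠ b → (lp.single p b z : EllP p (Fiber x.1)) d = 0 :=
    fun d hd => lp.single_apply_ne (E := fun _ : Fiber x.1 => ℂ) p b z hd
  rw [coe_regRep, fiberConv, finsum_eq_single _ b fun d hd => by rw [h_off d hd, mul_zero],
    lp.single_apply_self, ran]

variable [T2Space G] [CompactSpace (units G)]

theorem regRep_ofUnits_apply (x : units G) (f : C(units G, ℂ)) (ξ : EllP p (Fiber x.1))
    (b : Fiber x.1) :
    regRep p x (ConvAlg.ofUnits f : ConvAlg p G).toC ξ b = f (ranMap b.1) * ξ b := by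
  rw [coe_regRep, fiberConv, finsum_eq_single _ b]
  · exact congrArg (· * ξ b) (ConvAlg.ofUnits_apply f (ranMap b.1))
  · intro d hd
    have hdb : dom d.1 = dom b.1 := d.2.trans b.2.symm
    have h_notMem : mul b.1 (inv d.1) ∉ units G := fun hu => hd <| Subtype.ext <| by
      have h := mul_inv_mul hdb
      rwa [← dom_of_mem_units hu, dom_mul_inv hdb, ran_mul_self] at h
    exact mul_eq_zero_of_left (ConvAlg.ofUnits_apply_of_notMem f h_notMem) _

namespace ConvAlg

variable (p) in
/-- The regular representation `π_x` as a contractive homomorphism on `C_c(G)`. -/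
def regRepHom (x : units G) :
    ConvAlg p G →A[ℂ] EllP p (Fiber x.1) →L[ℂ] EllP p (Fiber x.1) where
  __ := AlgHom.ofLinearMap
    { toFun := fun f : ConvAlg p G => regRep p x f.toC
      map_add' := fun f g => regRep_add p x f.toC g.toC
      map_smul' := fun c f => regRep_smul p x c f.toC }
    (by
      ext ξ b
      exact (regRep_ofUnits_apply x 1 ξ b).trans (one_mul _))
    fun f g => regRep_convC p x f.toC g.toC
  cont := AddMonoidHomClass.continuous_of_bound _ 1 fun f =>
    (f.norm_regRep_le x).trans_eq (one_mul _).symm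

/-- The restriction to the unit space of the functions in `C_c(G)`. -/
def restrictUnits : ConvAlg p G →ₗ[ℂ] C(units G, ℂ) where
  toFun f := (f.toC : C(G, ℂ)).restrict (units G)
  map_add' _ _ := rfl
  map_smul' _ _ := rfl

theorem norm_restrictUnits_le (f : ConvAlg p G) : ‖restrictUnits f‖ ≤ ‖f‖ :=
  (ContinuousMap.norm_le _ (norm_nonneg f)).2 fun u => f.norm_apply_le u

end ConvAlg

namespace ReducedAlgebra

theorem isometry_ofConvAlg : Isometry (ofConvAlg p G) :=
  UniformSpace.Completion.coe_isometry (α := ConvAlg p G)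

theorem denseRange_ofConvAlg : DenseRange (ofConvAlg p G) :=
  UniformSpace.Completion.denseRange_coe (α := ConvAlg p G)

theorem norm_ofConvAlg (f : ConvAlg p G) : ‖ofConvAlg p G f‖ = ‖f‖ :=
  isometry_ofConvAlg.norm_map_of_map_zero (map_zero _) f

section Lift

variable {B : Type*} [NormedRing B] [NormedAlgebra ℂ B] [CompleteSpace B]

/-- The continuous extension to `F^p_λ(G)` of a homomorphism on `C_c(G)`. -/
def lift (φ : ConvAlg p G →A[ℂ] B) : ReducedAlgebra p G →A[ℂ] B where
  __ := UniformSpace.Completion.extensionHom (φ : ConvAlg p G →+* B) φ.cont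
  commutes' c :=
    (UniformSpace.Completion.extensionHom_coe (φ : ConvAlg p G →+* B) φ.cont _).trans
      (AlgHomClass.commutes φ c)
  cont := UniformSpace.Completion.continuous_extension

theorem lift_ofConvAlg (φ : ConvAlg p G →A[ℂ] B) (f : ConvAlg p G) :
    lift φ (ofConvAlg p G f) = φ f :=
  UniformSpace.Completion.extensionHom_coe (φ : ConvAlg p G →+* B) φ.cont f

theorem norm_lift_le {φ : ConvAlg p G →A[ℂ] B} (hφ : ∀ f, ‖φ f‖ ≤ ‖f‖) (a : ReducedAlgebra p G) :
    ‖lift φ a‖ ≤ ‖a‖ := by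
  refine denseRange_ofConvAlg.induction_on (p := fun a => ‖lift φ a‖ ≤ ‖a‖) a
    (isClosed_le (lift φ).cont.norm continuous_norm) fun f => ?_
  rw [lift_ofConvAlg, norm_ofConvAlg]
  exact hφ f

end Lift

section Representations

/-- The representation of `F^p_λ(G)` on `ℓ^p(Gx)` extending `π_x`. -/
def rep (x : units G) :
    ReducedAlgebra p G →A[ℂ] EllP p (Fiber x.1) →L[ℂ] EllP p (Fiber x.1) :=
  lift (ConvAlg.regRepHom p x)

theorem rep_ofConvAlg (x : units G) (f : ConvAlg p G) :
    rep x (ofConvAlg p G f) = regRep p x f.toC :=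
  lift_ofConvAlg _ f

theorem rep_ofUnits_apply (x : units G) (f : C(units G, ℂ)) (ξ : EllP p (Fiber x.1))
    (b : Fiber x.1) : rep x (ofUnits p G f) ξ b = f (ranMap b.1) * ξ b :=
  (congrArg (fun T => T ξ b) (rep_ofConvAlg x _)).trans (regRep_ofUnits_apply x f ξ b)

theorem norm_rep_le (x : units G) (a : ReducedAlgebra p G) : ‖rep x a‖ ≤ ‖a‖ :=
  norm_lift_le (fun f => f.norm_regRep_le x) a

theorem norm_le_of_norm_rep_le {a : ReducedAlgebra p G} {M : ℝ} (hM : 0 ≤ M)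
    (h : ∀ x : units G, ‖rep x a‖ ≤ M) : ‖a‖ ≤ M := by
  refine le_of_forall_pos_le_add fun ε hε => ?_
  obtain ⟨f, hf⟩ := denseRange_ofConvAlg.exists_dist_lt a (half_pos hε)
  rw [dist_eq_norm] at hf
  have norm_f_le : ‖f‖ ≤ M + ε / 2 := f.norm_le_of_regRep (by positivity) fun x => by
    calc ‖regRep p x f.toC‖ = ‖rep x a - rep x (a - ofConvAlg p G f)‖ := by
          rw [map_sub, sub_sub_cancel, rep_ofConvAlg]
      _ ≤ ‖rep x a‖ + ‖rep x (a - ofConvAlg p G f)‖ := norm_sub_le _ _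
      _ ≤ M + ε / 2 := add_le_add (h x) ((norm_rep_le x _).trans hf.le)
  calc ‖a‖ ≤ ‖a - ofConvAlg p G f‖ + ‖ofConvAlg p G f‖ := norm_le_norm_sub_add _ _
    _ ≤ M + ε := by rw [norm_ofConvAlg]; linarith

theorem eq_of_rep_eq {a b : ReducedAlgebra p G} (h : ∀ x : units G, rep x a = rep x b) :
    a = b := by
  refine sub_eq_zero.1 (norm_le_zero_iff.1 (norm_le_of_norm_rep_le le_rfl fun x => ?_))
  rw [map_sub, h x, sub_self, norm_zero]

end Representations

section Expectation

/-- The conditional expectation of `F^p_λ(G)` onto `C(G⁽⁰⁾)`: the continuous extension of the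
restriction of functions from `G` to the unit space. -/
def expectation : ReducedAlgebra p G →L[ℂ] C(units G, ℂ) :=
  LinearMap.extendOfNorm ConvAlg.restrictUnits (ofConvAlg p G).toLinearMap

theorem norm_restrictUnits_le_mul (f : ConvAlg p G) :
    ‖ConvAlg.restrictUnits f‖ ≤ 1 * ‖ofConvAlg p G f‖ := by
  rw [one_mul, norm_ofConvAlg]
  exact f.norm_restrictUnits_le

theorem expectation_ofConvAlg_apply (f : ConvAlg p G) (u : units G) :
    expectation (ofConvAlg p G f) u = f u :=
  DFunLike.congr_fun
    (LinearMap.extendOfNorm_eq denseRange_ofConvAlg ⟨1, norm_restrictUnits_le_mul⟩ f) u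

theorem norm_expectation_le (a : ReducedAlgebra p G) : ‖expectation a‖ ≤ ‖a‖ :=
  (LinearMap.norm_extendOfNorm_apply_le denseRange_ofConvAlg 1 norm_restrictUnits_le_mul a).trans_eq
    (one_mul _)

theorem expectation_ofUnits (f : C(units G, ℂ)) : expectation (ofUnits p G f) = f := by
  ext u
  exact (expectation_ofConvAlg_apply _ u).trans (ConvAlg.ofUnits_apply f u)

theorem rep_single_apply_self (x : units G) [DecidableEq (Fiber x.1)] (a : ReducedAlgebra p G)
    (b : Fiber x.1) (z : ℂ) :
    rep x a (lp.single p b z) b = expectation a (ranMap b.1) * z := by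
  have hrep : Continuous fun a : ReducedAlgebra p G => rep x a (lp.single p b z) b :=
    (lp.evalCLM ℂ (fun _ : Fiber x.1 => ℂ) p b).continuous.comp
      ((rep x).cont.clm_apply continuous_const)
  refine denseRange_ofConvAlg.induction_on
    (p := fun a => rep x a (lp.single p b z) b = expectation a (ranMap b.1) * z) a
    (isClosed_eq hrep (by fun_prop)) fun f => ?_
  rw [rep_ofConvAlg, regRep_single_apply_self, expectation_ofConvAlg_apply]
  rfl

theorem norm_ofUnits (f : C(units G, ℂ)) : ‖ofUnits p G f‖ = ‖f‖ := by
  refine le_antisymm (norm_le_of_norm_rep_le (norm_nonneg f) fun x => ?_) ?_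
  · refine ContinuousLinearMap.opNorm_le_bound _ (norm_nonneg f) fun ξ => ?_
    have norm_apply_le (b : Fiber x.1) :
        ‖rep x (ofUnits p G f) ξ b‖ ≤ ‖((‖f‖ : ℂ) • ξ) b‖ := by
      rw [rep_ofUnits_apply, lp.coeFn_smul, Pi.smul_apply, norm_smul, norm_mul, Complex.norm_real,
        norm_norm]
      exact mul_le_mul_of_nonneg_right (f.norm_coe_le_norm _) (norm_nonneg _)
    calc ‖rep x (ofUnits p G f) ξ‖ ≤ ‖(‖f‖ : ℂ) • ξ‖ :=
          lp.norm_mono (zero_lt_one.trans_le (Fact.out : 1 ≤ p)).ne' norm_apply_le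
      _ = ‖f‖ * ‖ξ‖ := by rw [norm_smul, Complex.norm_real, norm_norm]
  · simpa only [expectation_ofUnits] using norm_expectation_le (ofUnits p G f)

theorem isometry_ofUnits : Isometry (ofUnits p G) :=
  AddMonoidHomClass.isometry_of_norm _ norm_ofUnits

end Expectation

section Core

theorem ofUnits_expectation_of_isHermitianElement (hp : p ≠ ∞) (hp2 : p ≠ 2)
    {a : ReducedAlgebra p G} (ha : IsHermitianElement a) : ofUnits p G (expectation a) = a := by
  classical
  refine eq_of_rep_eq fun x => ?_
  ext ξ b
  have hermitian_rep : IsHermitianElement (rep x a) := ha.map (rep x) (norm_rep_le x)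
  have diagonal : rep x a (ξ - lp.single p b (ξ b)) b = 0 :=
    hermitian_rep.apply_eq_zero_of_apply_eq_zero hp hp2 (by simp)
  rw [map_sub, lp.coeFn_sub, Pi.sub_apply, sub_eq_zero, rep_single_apply_self] at diagonal
  rw [rep_ofUnits_apply, diagonal]

instance [Nonempty G] : NormOneClass (ReducedAlgebra p G) :=
  ⟨by rw [← map_one (ofUnits p G), norm_ofUnits, norm_one]⟩

theorem cstarCore_eq_range_ofUnits [Nonempty G] (hp : p ≠ ∞) (hp2 : p ≠ 2) :
    cstarCore (ReducedAlgebra p G) = Set.range (ofUnits p G) := by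
  refine Set.Subset.antisymm ?_ (range_subset_cstarCore _ fun f => (norm_ofUnits f).le)
  exact cstarCore_subset (V := LinearMap.range (ofUnits p G).toLinearMap) fun a ha =>
    ⟨expectation a, ofUnits_expectation_of_isHermitianElement hp hp2 ha⟩

end Core

end ReducedAlgebra

end ReducedAlgebra

end LpGroupoid

theorem mainTheorem10 {G : Type*} [TopologicalSpace G] [T2Space G] [Nonempty G]
    [LpGroupoid.TopologicalGroupoid G] [LpGroupoid.IsEtale G]
    [CompactSpace (LpGroupoid.units G)]
    (p : ℝ≥0∞) [Fact (1 ≤ p)] (hp : p ≠ ∞) (hp2 : p ≠ 2) :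
    Isometry (LpGroupoid.ReducedAlgebra.ofUnits p G) ∧
      LpGroupoid.cstarCore (LpGroupoid.ReducedAlgebra p G) =
        Set.range (LpGroupoid.ReducedAlgebra.ofUnits p G) :=
  ⟨LpGroupoid.ReducedAlgebra.isometry_ofUnits,
    LpGroupoid.ReducedAlgebra.cstarCore_eq_range_ofUnits hp hp2⟩
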